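/- **Conventions.** Let $\lambda\in\mathbb N$ be the security parameter. Efficient algorithms are non-uniform. A classical algorithm is a family, indexed by $\lambda$, of Boolean (NAND) circuits that also read fair coins; its time is the number of coins plus the number of gates. A quantum algorithm is a family of circuits over the gates $X,H,T$, CNOT, Toffoli with ancillas initialized to $|0\rangle$; its time is the number of ancillas plus the number of gates, and its output is the outcome of measuring one designated qubit. "Efficient" means that the time is bounded by a polynomial in $\lambda$. A function of $\lambda$ is *negligible* if it tends to $0$ faster than every inverse polynomial, and *noticeable* if it is at least $1/p(\lambda)$ for some polynomial $p$ and all large $\lambda$. For every $\lambda$ let $\mathcal C=\{C_1,\dots,C_N\}$, $N=N(\lambda)\ge 1$, be a family of quantum circuits (over the above gates) on $n=n(\lambda)$ qubits with at most $q=q(\lambda)$ gates, where $n$ and $q$ are bounded by polynomials in $\lambda$. Let $D_C$ be the distribution on $\{0,1\}^n$ obtained by measuring $C|0^n\rangle$ in the computational basis. * $\mathcal C$ is an *$(s,t,\varepsilon)$-verifiable quantum advantage (VQA)* if for every distribution $D$ on $\{0,1\}^n$ (for each $\lambda$) that is the output distribution of a classical time-$s$ sampler $S_D$, there is a classical time-$t$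 algorithm $A$, using $m\le t$ samples, such that for all $\lambda$ $$\frac1N\sum_{k=1}^N\bigl|\Pr[A(C_k,S_D,z_{C_k})=1]-\Pr[A(C_k,S_D,z_D)=1]\bigr|\ge\varepsilon(\lambda),$$ where $C_k$ and $S_D$ are given by their descriptions as bit strings, and $z_{C_k}$, $z_D$ consist of $m$ independent samples of $D_{C_k}$, respectively of $D$. * The family of states $|\phi_k\rangle=C_k|0^n\rangle$, $1\le k\le N$, is a *pseudorandom state family (PRS)* if (i) for some injective encoding of the keys $k$ by bit strings of polynomial length, there are polynomial-size quantum circuits that, for each $k$, map $|k\rangle|0^n\rangle|0^a\rangle$ to a state that is the product of $|\phi_k\rangle$ on the output register and some state of the other qubits; and (ii) for every polynomially bounded $m$ and every efficient quantum algorithm $A$, $$\Bigl|\frac1N\sum_{k=1}^N\Pr[A(|\phi_k\rangle^{\otimes m})=1]-\mathop{\mathbb E}_{\psi\sim\mu}\Pr[A(|\psi\rangle^{\otimes m})=1]\Bigr|$$ is negligible in $\lambda$, where $\mu$ is the Haar probability measure on the unit sphere of $(\mathbb C^2)^{\otimes n}$. * The family is *classically unidentifiable* if for every polynomially bounded $m$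 and every efficient classical algorithm $A$ there is a negligible function $\nu$ such that for all $\lambda$ and all $i\ne j$, $$\bigl|\Pr[A(C_i,z_i)=1]-\Pr[A(C_i,z_j)=1]\bigr|\le\nu(\lambda),$$ where $z_i$ consists of $m$ independent samples of $D_{C_i}$. **Theorem.** Let $s,t:\mathbb N\to\mathbb N$ and $\varepsilon:\mathbb N\to\mathbb R$, where $s\ge n$, $t$ is bounded by a polynomial and $\varepsilon$ is noticeable. If $\mathcal C$ is an $(s,t,\varepsilon)$-VQA, then the states $\{C_1|0^n\rangle,\dots,C_N|0^n\rangle\}$ are not a classically unidentifiable PRS; that is, they are not both a PRS and classically unidentifiable. -/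

import Mathlib

open MeasureTheory Filter

noncomputable section

namespace RCS

/-! ### Growth conditions in the security parameter -/

/-- `f` is bounded by a polynomial in the security parameter. -/
def PolyBounded (f : ℕ → ℕ) : Prop :=
  ∃ p : Polynomial ℕ, ∀ l, f l ≤ p.eval l

/-- `f` is negligible: it tends to `0` faster than every inverse polynomial. -/
def Negligible (f : ℕ → ℝ) : Prop :=
  Asymptotics.SuperpolynomialDecay atTop (fun l : ℕ => (l : ℝ)) f

/-- `f ≥ 1 / poly` for all large security parameters. -/
def Noticeable (f : ℕ → ℝ) : Prop :=
  ∃ p : Polynomial ℕ, ∀ᶠ l : ℕ in atTop, 1 ≤ f l * ((p.eval l : ℕ) : ℝ)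

/-! ### Classical circuits -/

/-- A place from which a gate of a Boolean circuit reads: a constant, an input bit, or the value
of the gate number `k`. -/
inductive Wire (ι : Type)
  | const (b : Bool)
  | input (i : ι)
  | gate (k : ℕ)

/-- The bit on a wire, for the input `x` and the values `v` of the gates computed so far
(a gate that has not been computed carries `false`). -/
def Wire.read {ι : Type} (x : ι → Bool) (v : List Bool) : Wire ι → Bool
  | .const b => b
  | .input i => x i
  | .gate k => v.getD k false

/-- A Boolean circuit with input bits named by `ι` and output bits named by `o`: a list of NAND
gates in the order of evaluation, and for each output bit the wire that carries it. -/
structure BoolCircuit (ι o : Type) where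
  gates : List (Wire ι × Wire ι)
  out : o → Wire ι

/-- The values of all gates. -/
def BoolCircuit.values {ι o : Type} (c : BoolCircuit ι o) (x : ι → Bool) : List Bool :=
  c.gates.foldl (fun v g => v ++ [!(g.1.read x v && g.2.read x v)]) []

/-- The output of a Boolean circuit. -/
def BoolCircuit.eval {ι o : Type} (c : BoolCircuit ι o) (x : ι → Bool) : o → Bool :=
  fun j => (c.out j).read x (c.values x)

/-- A probabilistic classical circuit: it reads its input and a number of fair coins. -/
structure ProbCircuit (ι o : Type) where
  coins : ℕ
  circuit : BoolCircuit (ι ⊕ Fin coins) o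

/-- The running time: the number of coin tosses plus the number of gates. -/
def ProbCircuit.time {ι o : Type} (A : ProbCircuit ι o) : ℕ :=
  A.coins + A.circuit.gates.length

open Classical in
/-- The probability, over the coins, that `A` outputs `y` on input `x`. -/
def ProbCircuit.prob {ι o : Type} (A : ProbCircuit ι o) (x : ι → Bool) (y : o → Bool) : ℝ :=
  ((Finset.univ.filter fun r : Fin A.coins → Bool =>
    A.circuit.eval (Sum.elim x r) = y).card : ℝ) / 2 ^ A.coins

/-- The probability that a one-bit algorithm outputs `1` on input `x`. -/
def ProbCircuit.accept {ι : Type} (A : ProbCircuit ι Unit) (x : ι → Bool) : ℝ :=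
  A.prob x fun _ => true

/-- A classical sampler of `n`-bit strings: a probabilistic circuit without input. -/
abbrev Sampler (n : ℕ) := ProbCircuit Empty (Fin n)

/-- The distribution of the output of a sampler. -/
def Sampler.dist {n : ℕ} (S : Sampler n) (y : Fin n → Bool) : ℝ :=
  ProbCircuit.prob S Empty.elim y

/-- The probability that `A` outputs `1` on the input consisting of the bits `a` and of `m`
independent samples of the distribution `D` on `n`-bit strings. -/
def acceptOnSamples {α : Type} {m n : ℕ} (A : ProbCircuit (α ⊕ Fin m × Fin n) Unit)
    (a : α → Bool) (D : (Fin n → Bool) → ℝ) : ℝ :=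
  ∑ z : Fin m → Fin n → Bool,
    (∏ i, D (z i)) * A.accept (Sum.elim a fun p => z p.1 p.2)

/-! Descriptions of samplers as bit strings (unary encoding of all indices). -/

/-- The bit positions of the description of one wire in a sampler of time at most `s`. -/
abbrev WireCode (s : ℕ) := Bool ⊕ Fin s ⊕ Fin s

/-- The description of a wire of a sampler. -/
def Wire.code (s : ℕ) {c : ℕ} : Wire (Empty ⊕ Fin c) → WireCode s → Bool
  | .const b, .inl b' => b == b'
  | .input (.inr i), .inr (.inl j) => i.val == j.val
  | .gate k, .inr (.inr j) => k == j.val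
  | _, _ => false

/-- The bit positions of the description of a sampler of `n`-bit strings of time at most `s`:
the two wires read by each gate, and the output wires. -/
abbrev SamplerCode (s n : ℕ) := Fin s × Bool × WireCode s ⊕ Fin n × WireCode s

/-- The description of a sampler. -/
def Sampler.code (s : ℕ) {n : ℕ} (S : Sampler n) : SamplerCode s n → Bool
  | .inl (j, side, b) =>
      match S.circuit.gates[j.val]? with
      | some g => (if side then g.2 else g.1).code s b
      | none => false
  | .inr (i, b) => (S.circuit.out i).code s b

/-! ### Quantum circuits -/

/-- The gates `X`, `H`, `T`, CNOT and Toffoli on qubits named by `W`;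
the last argument of `cnot` and `ccnot` is the target. -/
inductive QGate (W : Type)
  | x (a : W)
  | h (a : W)
  | t (a : W)
  | cnot (a b : W) (hab : a ≠ b)
  | ccnot (a b c : W) (hab : a ≠ b) (hac : a ≠ c) (hbc : b ≠ c)

/-- The amplitudes, in the computational basis, of a pure state of the qubits `W`. -/
abbrev Amp (W : Type) := (W → Bool) → ℂ

/-- The action of a gate on a state. -/
def QGate.apply {W : Type} [DecidableEq W] (ψ : Amp W) : QGate W → Amp W
  | .x a => fun y => ψ (Function.update y a (!y a))
  | .h a => fun y => (ψ (Function.update y a false) +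
      (if y a then -1 else 1) * ψ (Function.update y a true)) / (Real.sqrt 2 : ℂ)
  | .t a => fun y => (if y a then Complex.exp (Complex.I * Real.pi / 4) else 1) * ψ y
  | .cnot a b _ => fun y => ψ (Function.update y b (xor (y b) (y a)))
  | .ccnot a b c _ _ _ => fun y => ψ (Function.update y c (xor (y c) (y a && y b)))

/-- A quantum circuit: a list of gates in the order of application. -/
abbrev QCircuit (W : Type) := List (QGate W)

/-- The action of a circuit on a state. -/
def QCircuit.run {W : Type} [DecidableEq W] (C : QCircuit W) (ψ : Amp W) : Amp W :=
  List.foldl QGate.apply ψ C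

/-- The computational basis state `|b⟩`. -/
def ket {W : Type} [Fintype W] (b : W → Bool) : Amp W :=
  fun y => if y = b then 1 else 0

/-- The state `C|0ⁿ⟩`. -/
def QCircuit.state {n : ℕ} (C : QCircuit (Fin n)) : Amp (Fin n) :=
  QCircuit.run C (ket fun _ => false)

/-- The distribution of the outcome of measuring `ψ` in the computational basis. -/
def measure {W : Type} (ψ : Amp W) (y : W → Bool) : ℝ := ‖ψ y‖ ^ 2

/-- The number of the kind of a gate. -/
def QGate.kind {W : Type} : QGate W → Fin 5
  | .x _ => 0
  | .h _ => 1
  | .t _ => 2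
  | .cnot _ _ _ => 3
  | .ccnot _ _ _ _ _ _ => 4

/-- The qubits on which a gate acts, in order. -/
def QGate.qubits {W : Type} : QGate W → List W
  | .x a => [a]
  | .h a => [a]
  | .t a => [a]
  | .cnot a b _ => [a, b]
  | .ccnot a b c _ _ _ => [a, b, c]

/-- The bit positions of the description of an `n`-qubit circuit of at most `q` gates. -/
abbrev QCode (q n : ℕ) := Fin q × (Fin 5 ⊕ Fin 3 × Fin n)

/-- The description of a quantum circuit (unary encoding of all indices): for each gate its kind
and the qubits on which it acts. -/
def QCircuit.code (q : ℕ) {n : ℕ} (C : QCircuit (Fin n)) : QCode q n → Bool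
  | (j, b) =>
      match (show List (QGate (Fin n)) from C)[j.val]? with
      | none => false
      | some g =>
          match b with
          | .inl k => decide (g.kind = k)
          | .inr (i, w) => decide (g.qubits[i.val]? = some w)

/-- A quantum algorithm that receives `m` copies of an `n`-qubit state, adjoins `anc` qubits in the
state `|0⟩`, applies a circuit, and outputs the outcome of measuring the qubit `out`. -/
structure QDistinguisher (m n : ℕ) where
  anc : ℕ
  circuit : QCircuit (Fin m × Fin n ⊕ Fin anc)
  out : Fin m × Fin n ⊕ Fin anc

/-- The running time: the number of ancillas plus the number of gates. -/
def QDistinguisher.time {m n : ℕ} (A : QDistinguisher m n) : ℕ :=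
  A.anc + A.circuit.length

/-- The state `|ψ⟩^{⊗ m} ⊗ |0^a⟩`. -/
def copies (m a : ℕ) {n : ℕ} (ψ : Amp (Fin n)) : Amp (Fin m × Fin n ⊕ Fin a) :=
  fun y => (∏ i, ψ fun j => y (.inl (i, j))) * if ∀ k, y (.inr k) = false then 1 else 0

/-- The probability that `A` outputs `1` on `|ψ⟩^{⊗ m}`. -/
def QDistinguisher.accept {m n : ℕ} (A : QDistinguisher m n) (ψ : Amp (Fin n)) : ℝ :=
  ∑ y : Fin m × Fin n ⊕ Fin A.anc → Bool,
    if y A.out then measure (A.circuit.run (copies m A.anc ψ)) y else 0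

/-- The Hilbert space of `n` qubits. -/
abbrev Qubits (n : ℕ) := EuclideanSpace ℂ (Fin n → Bool)

/-- The Haar measure on the pure states of `n` qubits: the surface measure of the unit sphere,
normalized to a probability measure. -/
def haar (n : ℕ) : Measure (Metric.sphere (0 : Qubits n) 1) :=
  ((volume : Measure (Qubits n)).toSphere Set.univ)⁻¹ • (volume : Measure (Qubits n)).toSphere

/-! ### Circuit families, verifiable quantum advantage, pseudorandom states -/

/-- A family of polynomial-size quantum circuits: for each security parameter `l`, circuits
`C_1, …, C_N` with `N = N l ≥ 1`, on `n l` qubits and with at most `q l` gates. -/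
structure CircuitFamily where
  n : ℕ → ℕ
  N : ℕ → ℕ
  q : ℕ → ℕ
  circ : (l : ℕ) → Fin (N l) → QCircuit (Fin (n l))
  N_pos : ∀ l, 0 < N l
  n_poly : PolyBounded n
  q_poly : PolyBounded q
  length_le : ∀ l k, (circ l k).length ≤ q l

namespace CircuitFamily

variable (F : CircuitFamily)

/-- The state `C_k|0ⁿ⟩`. -/
def state (l : ℕ) (k : Fin (F.N l)) : Amp (Fin (F.n l)) := (F.circ l k).state

/-- The output distribution of `C_k`. -/
def dist (l : ℕ) (k : Fin (F.N l)) : (Fin (F.n l) → Bool) → ℝ := measure (F.state l k)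

/-- The description of `C_k`. -/
def desc (l : ℕ) (k : Fin (F.N l)) : QCode (F.q l) (F.n l) → Bool := (F.circ l k).code (F.q l)

/-- `(s, t, ε)`-verifiable quantum advantage: for every distribution `D` with a time-`s` classical
sampler there is a time-`t` classical algorithm `A` which, given the circuit `C`, the
sampler of `D` and `m ≤ t` samples, tells `D_C` from `D` with advantage at least `ε` on average
over a uniformly random circuit `C` of the family. -/
def VQA (s t : ℕ → ℕ) (ε : ℕ → ℝ) : Prop :=
  ∀ S : (l : ℕ) → Sampler (F.n l), (∀ l, (S l).time ≤ s l) →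
    ∃ (m : ℕ → ℕ) (A : (l : ℕ) →
      ProbCircuit ((QCode (F.q l) (F.n l) ⊕ SamplerCode (s l) (F.n l)) ⊕
        Fin (m l) × Fin (F.n l)) Unit),
      ∀ l, m l ≤ t l ∧ (A l).time ≤ t l ∧
        ε l ≤ (∑ k, |acceptOnSamples (A l) (Sum.elim (F.desc l k) ((S l).code (s l))) (F.dist l k) -
          acceptOnSamples (A l) (Sum.elim (F.desc l k) ((S l).code (s l))) (S l).dist|) / F.N l

/-- Classical unidentifiability: an efficient classical algorithm that is given `C_i` does not
tell samples of `D_{C_i}` from samples of `D_{C_j}`. -/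
def ClassicallyUnidentifiable : Prop :=
  ∀ (m : ℕ → ℕ) (A : (l : ℕ) →
      ProbCircuit (QCode (F.q l) (F.n l) ⊕ Fin (m l) × Fin (F.n l)) Unit),
    PolyBounded m → PolyBounded (fun l => (A l).time) →
    ∃ ν : ℕ → ℝ, Negligible ν ∧ ∀ l i j, i ≠ j →
      |acceptOnSamples (A l) (F.desc l i) (F.dist l i) -
        acceptOnSamples (A l) (F.desc l i) (F.dist l j)| ≤ ν l

end CircuitFamily

/-- A keyed family of pure states `φ l k` of `n l` qubits is generated efficiently: for some
encoding of the keys as bit strings of polynomial length, polynomial-size quantum circuits `G l`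
map `|k⟩|0ⁿ⟩|0^a⟩` to `|φ_k⟩` on the output register, in tensor product with some state of the
other qubits. -/
def EfficientlyGenerated (n N : ℕ → ℕ) (φ : (l : ℕ) → Fin (N l) → Amp (Fin (n l))) : Prop :=
  ∃ (κ a : ℕ → ℕ) (key : (l : ℕ) → Fin (N l) → Fin (κ l) → Bool)
    (G : (l : ℕ) → QCircuit (Fin (κ l) ⊕ Fin (n l) ⊕ Fin (a l))),
    PolyBounded κ ∧ PolyBounded a ∧ PolyBounded (fun l => (G l).length) ∧
    (∀ l, Function.Injective (key l)) ∧
    ∀ l k, ∃ rest : (Fin (κ l) → Bool) → (Fin (a l) → Bool) → ℂ,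
      ∀ (x : Fin (κ l) → Bool) (y : Fin (n l) → Bool) (z : Fin (a l) → Bool),
        (G l).run (ket (Sum.elim (key l k) (fun _ => false))) (Sum.elim x (Sum.elim y z)) =
          rest x z * φ l k y

/-- Pseudorandomness: polynomially many copies of `φ_k`, for a uniformly random key `k`, are
computationally indistinguishable from as many copies of a Haar random state. -/
def Pseudorandom (n N : ℕ → ℕ) (φ : (l : ℕ) → Fin (N l) → Amp (Fin (n l))) : Prop :=
  ∀ (m : ℕ → ℕ) (A : (l : ℕ) → QDistinguisher (m l) (n l)),
    PolyBounded m → PolyBounded (fun l => (A l).time) →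
    Negligible fun l =>
      |(∑ k, (A l).accept (φ l k)) / N l -
        ∫ ψ : Metric.sphere (0 : Qubits (n l)) 1, (A l).accept (fun y => ψ.val y) ∂haar (n l)|

/-- Pseudorandom quantum states. -/
structure IsPRS (n N : ℕ → ℕ) (φ : (l : ℕ) → Fin (N l) → Amp (Fin (n l))) : Prop where
  efficient : EfficientlyGenerated n N φ
  pseudorandom : Pseudorandom n N φ

end RCS

end

open MeasureTheory Filter

noncomputable section

namespace RCS

/-! ### The Haar measure on pure states -/

/-! The contradiction arises already for the uniform distribution `D`. Averaging over the circuits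
and the coins turns a VQA algorithm into a deterministic polynomial-size test `T` and a key `k`, for
each security parameter, such that `T` tells samples of the `k`-th circuit from uniform ones with
advantage at least `ε`; non-uniformity allows the description and the coins to be hardwired.

For a classically unidentifiable PRS no such test exists. Unidentifiability replaces the `k`-th
circuit by the average over all keys; pseudorandomness replaces this average by a Haar random state,
since a reversible quantum circuit can run `T` on the copies (`exists_qDistinguisher`). Both steps
are joined in `CircuitFamily.exists_negligible_test`. By `abs_integral_haar_sub_uniform_le`, `m`
outcomes from one Haar random state are uniform up to `8 m² / (2 ^ n + 1)`: their joint law is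
constant on injective tuples, and repetitions are rare.

It remains to see that `2 ^ n` is superpolynomial (`CircuitFamily.exists_negligible_inv_dim`). Two
samples of a fixed state are independent, whereas two samples of the same Haar random state are
correlated by an amount of order `1 / 2 ^ n`, and two constant-size tests would detect a noticeable
correlation. The case `n = 0` is separate: there the output is already uniform. -/

/-- The restriction of a linear isometry of the space of `n` qubits to the unit sphere. -/
def sphereHomeomorph {n : ℕ} (e : Qubits n ≃ₗᵢ[ℝ] Qubits n) :
    Metric.sphere (0 : Qubits n) 1 ≃ₜ Metric.sphere (0 : Qubits n) 1 :=
  e.toHomeomorph.subtype fun x => by simp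

-- The sphere measure of a set is, up to a constant, the volume of the cone over it. A linear map
-- commutes with forming cones, and an isometry preserves volume.
open Pointwise in
theorem measurePreserving_toSphere {n : ℕ} (e : Qubits n ≃ₗᵢ[ℝ] Qubits n) :
    MeasurePreserving (sphereHomeomorph e) (volume : Measure (Qubits n)).toSphere
      (volume : Measure (Qubits n)).toSphere := by
  refine ⟨(sphereHomeomorph e).continuous.measurable, ?_⟩
  ext s hs
  rw [Measure.map_apply (sphereHomeomorph e).continuous.measurable hs,
    Measure.toSphere_apply' _ hs,
    Measure.toSphere_apply' _ ((sphereHomeomorph e).continuous.measurable hs)]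
  congr 1
  have key : Set.Ioo (0 : ℝ) 1 • Set.image Subtype.val (Set.preimage (sphereHomeomorph e) s) =
      Set.preimage e (Set.Ioo (0 : ℝ) 1 • Set.image Subtype.val s) := by
    ext x
    simp only [Set.mem_smul, Set.mem_image, Set.mem_preimage]
    constructor
    · rintro ⟨r, hr, y, ⟨u, hu, rfl⟩, rfl⟩
      exact ⟨r, hr, _, ⟨_, hu, rfl⟩, by simp [sphereHomeomorph]⟩
    · rintro ⟨r, hr, y, ⟨u, hu, rfl⟩, h⟩
      refine ⟨r, hr, _, ⟨(sphereHomeomorph e).symm u, by simpa using hu, rfl⟩, ?_⟩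
      apply e.injective
      rw [← h]
      simp [sphereHomeomorph]
  rw [key]
  exact e.measurePreserving.measure_preimage_equiv (f := e.toHomeomorph.toMeasurableEquiv) _

instance (n : ℕ) : IsProbabilityMeasure (haar n) := by
  have h0 : (volume : Measure (Qubits n)).toSphere Set.univ ≠ 0 := by
    rw [ne_eq, Measure.measure_univ_eq_zero]
    exact Measure.toSphere_ne_zero (volume : Measure (Qubits n))
  refine ⟨?_⟩
  rw [haar, Measure.smul_apply, smul_eq_mul]
  exact ENNReal.inv_mul_cancel h0 (measure_ne_top _ _)

theorem integral_haar_comp {n : ℕ} (e : Qubits n ≃ₗᵢ[ℝ] Qubits n) (f : Qubits n → ℝ) :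
    ∫ ψ : Metric.sphere (0 : Qubits n) 1, f (e ψ.val) ∂haar n =
      ∫ ψ : Metric.sphere (0 : Qubits n) 1, f ψ.val ∂haar n := by
  simp only [haar, integral_smul_measure]
  congr 1
  exact (measurePreserving_toSphere e).integral_comp
    (sphereHomeomorph e).measurableEmbedding (fun ψ => f ψ.val)

theorem integral_haar_comp_complex {n : ℕ} (e : Qubits n ≃ₗᵢ[ℂ] Qubits n) (f : Qubits n → ℝ) :
    ∫ ψ : Metric.sphere (0 : Qubits n) 1, f (e ψ.val) ∂haar n =
      ∫ ψ : Metric.sphere (0 : Qubits n) 1, f ψ.val ∂haar n :=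
  integral_haar_comp
    { toLinearEquiv := e.toLinearEquiv.restrictScalars ℝ, norm_map' := e.norm_map } f

theorem integrable_haar {n : ℕ} {f : Metric.sphere (0 : Qubits n) 1 → ℝ} (hf : Continuous f) :
    Integrable f (haar n) :=
  hf.integrable_of_hasCompactSupport (HasCompactSupport.of_compactSpace f)

theorem integral_haar_perm {n : ℕ} (σ : Equiv.Perm (Fin n → Bool)) (f : Qubits n → ℝ) :
    ∫ ψ : Metric.sphere (0 : Qubits n) 1, f (WithLp.toLp 2 fun x => ψ.val (σ x)) ∂haar n =
      ∫ ψ : Metric.sphere (0 : Qubits n) 1, f ψ.val ∂haar n := by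
  rw [← integral_haar_comp_complex (LinearIsometryEquiv.piLpCongrLeft 2 ℂ ℂ σ.symm) f]
  rfl

/-- The law of the overlap of a Haar random state with a unit vector does not depend on the
unit vector. -/
theorem integral_haar_inner {n : ℕ} (v : Qubits n) (hv : ‖v‖ = 1) (x : Fin n → Bool)
    (f : ℂ → ℝ) :
    ∫ ψ : Metric.sphere (0 : Qubits n) 1, f (inner ℂ v ψ.val) ∂haar n =
      ∫ ψ : Metric.sphere (0 : Qubits n) 1, f (ψ.val x) ∂haar n := by
  obtain ⟨b, hb⟩ := Orthonormal.exists_orthonormalBasis_extension_of_card_eq (𝕜 := ℂ)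
    (E := Qubits n) (ι := Fin n → Bool) (by simp) (v := fun _ => v) (s := {x})
    (by
      rw [orthonormal_iff_ite]
      rintro ⟨i, rfl⟩ ⟨j, rfl⟩
      simp [hv])
  rw [← integral_haar_comp_complex b.repr (fun φ => f (φ x))]
  simp [b.repr_apply_apply, hb x rfl]

/-! ### Moments of the outcome probabilities of a Haar random state. -/

theorem sum_measure_eq_one {n : ℕ} (ψ : Metric.sphere (0 : Qubits n) 1) :
    ∑ x, ‖ψ.val x‖ ^ 2 = 1 := by
  rw [← EuclideanSpace.norm_sq_eq]
  simp

theorem integral_haar_coord {n : ℕ} (x y : Fin n → Bool) (f : ℂ → ℝ) :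
    ∫ ψ : Metric.sphere (0 : Qubits n) 1, f (ψ.val x) ∂haar n =
      ∫ ψ : Metric.sphere (0 : Qubits n) 1, f (ψ.val y) ∂haar n := by
  rw [← integral_haar_perm (Equiv.swap x y) fun φ => f (φ y)]
  simp

/-- The `2 ^ n` means are equal by symmetry and add up to `1`. -/
theorem integral_haar_sq {n : ℕ} (x : Fin n → Bool) :
    ∫ ψ : Metric.sphere (0 : Qubits n) 1, ‖ψ.val x‖ ^ 2 ∂haar n = 1 / 2 ^ n := by
  have h : ∑ y : Fin n → Bool,
      ∫ ψ : Metric.sphere (0 : Qubits n) 1, ‖ψ.val y‖ ^ 2 ∂haar n = 1 := by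
    rw [← integral_finsetSum _ fun y _ => integrable_haar (by fun_prop)]
    simp [sum_measure_eq_one]
  rw [Finset.sum_congr rfl fun y _ => integral_haar_coord y x fun z => ‖z‖ ^ 2] at h
  simp only [Finset.sum_const, Finset.card_univ, Fintype.card_fun, Fintype.card_bool,
    Fintype.card_fin, nsmul_eq_mul, Nat.cast_pow, Nat.cast_ofNat] at h
  field_simp
  linarith

/-- Up to the factor `√2`, the integrand is the overlap with the unit vector `(e_x + ω̄ e_y) / √2`,
which is distributed like a coordinate; the constant is `√2 ^ 4`. -/
theorem integral_haar_superposition {n : ℕ} {x y : Fin n → Bool} (hxy : x ≠ y) (ω : ℂ)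
    (hω : ‖ω‖ = 1) :
    ∫ ψ : Metric.sphere (0 : Qubits n) 1, ‖ψ.val x + ω * ψ.val y‖ ^ 4 ∂haar n =
      4 * ∫ ψ : Metric.sphere (0 : Qubits n) 1, ‖ψ.val x‖ ^ 4 ∂haar n := by
  have h2 : (0 : ℝ) < Real.sqrt 2 := by positivity
  have hinner (ψ : Qubits n) : inner ℂ ((((Real.sqrt 2)⁻¹ : ℝ) : ℂ) •
      (EuclideanSpace.single x 1 + EuclideanSpace.single y (starRingEnd ℂ ω) : Qubits n)) ψ =
      (((Real.sqrt 2)⁻¹ : ℝ) : ℂ) * (ψ x + ω * ψ y) := by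
    simp [EuclideanSpace.inner_single_left]
    ring
  rw [← integral_haar_inner ((((Real.sqrt 2)⁻¹ : ℝ) : ℂ) •
      (EuclideanSpace.single x 1 + EuclideanSpace.single y (starRingEnd ℂ ω) : Qubits n))
      ?_ x fun z => ‖z‖ ^ 4, ← integral_const_mul]
  · congr 1 with ψ
    have h4 : Real.sqrt 2 ^ 4 = 4 := by
      rw [show (4 : ℕ) = 2 * 2 from rfl, pow_mul, Real.sq_sqrt (by norm_num)]; norm_num
    rw [hinner, norm_mul, mul_pow, Complex.norm_real, norm_inv, Real.norm_of_nonneg h2.le, inv_pow,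
      h4]
    ring
  · have h3 : ‖(EuclideanSpace.single x 1 +
        EuclideanSpace.single y (starRingEnd ℂ ω) : Qubits n)‖ ^ 2 = 2 := by
      rw [norm_add_sq (𝕜 := ℂ)]
      simp [EuclideanSpace.inner_single_left, hω, hxy]
      norm_num
    rw [norm_smul, Complex.norm_real, norm_inv, Real.norm_of_nonneg h2.le,
      show ‖(EuclideanSpace.single x 1 +
        EuclideanSpace.single y (starRingEnd ℂ ω) : Qubits n)‖ = Real.sqrt 2 by
        rw [← h3, Real.sqrt_sq (norm_nonneg _)]]
    exact inv_mul_cancel₀ h2.ne'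

/-- Summing over the fourth roots of unity cancels the terms linear in the interference `2 Re (a *
conj (ω b))`, while its squares add up to `8 ‖a‖² ‖b‖²`. -/
theorem norm_pow_four_polarization (a b : ℂ) :
    ‖a + 1 * b‖ ^ 4 + ‖a + -1 * b‖ ^ 4 + ‖a + Complex.I * b‖ ^ 4 + ‖a + -Complex.I * b‖ ^ 4 =
      4 * ‖a‖ ^ 4 + 4 * ‖b‖ ^ 4 + 16 * (‖a‖ ^ 2 * ‖b‖ ^ 2) := by
  have h (z : ℂ) : ‖z‖ ^ 4 = (z.re ^ 2 + z.im ^ 2) ^ 2 := by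
    rw [show (4 : ℕ) = 2 * 2 from rfl, pow_mul, Complex.sq_norm, Complex.normSq_apply]
    ring
  have h' (z : ℂ) : ‖z‖ ^ 2 = z.re ^ 2 + z.im ^ 2 := by
    rw [Complex.sq_norm, Complex.normSq_apply]
    ring
  simp only [h, h']
  simp
  ring

/-- With `A` the fourth moment and `B` the mixed moment, integrating the polarization identity gives
`16 A = 8 A + 16 B`. -/
theorem integral_haar_pair {n : ℕ} {x y : Fin n → Bool} (hxy : x ≠ y) :
    ∫ ψ : Metric.sphere (0 : Qubits n) 1, ‖ψ.val x‖ ^ 4 ∂haar n =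
      2 * ∫ ψ : Metric.sphere (0 : Qubits n) 1, ‖ψ.val x‖ ^ 2 * ‖ψ.val y‖ ^ 2 ∂haar n := by
  have h : ∫ ψ : Metric.sphere (0 : Qubits n) 1,
      (‖ψ.val x + 1 * ψ.val y‖ ^ 4 + ‖ψ.val x + -1 * ψ.val y‖ ^ 4 +
        ‖ψ.val x + Complex.I * ψ.val y‖ ^ 4 + ‖ψ.val x + -Complex.I * ψ.val y‖ ^ 4) ∂haar n =
      ∫ ψ : Metric.sphere (0 : Qubits n) 1, (4 * ‖ψ.val x‖ ^ 4 + 4 * ‖ψ.val y‖ ^ 4 +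
        16 * (‖ψ.val x‖ ^ 2 * ‖ψ.val y‖ ^ 2)) ∂haar n := by
    simp only [norm_pow_four_polarization]
  rw [integral_add (integrable_haar (by fun_prop)) (integrable_haar (by fun_prop)),
    integral_add (integrable_haar (by fun_prop)) (integrable_haar (by fun_prop)),
    integral_add (integrable_haar (by fun_prop)) (integrable_haar (by fun_prop)),
    integral_add (integrable_haar (by fun_prop)) (integrable_haar (by fun_prop)),
    integral_add (integrable_haar (by fun_prop)) (integrable_haar (by fun_prop)),
    integral_const_mul, integral_const_mul, integral_const_mul,
    integral_haar_superposition hxy _ (by simp), integral_haar_superposition hxy _ (by simp),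
    integral_haar_superposition hxy _ (by simp), integral_haar_superposition hxy _ (by simp),
    integral_haar_coord y x fun z => ‖z‖ ^ 4] at h
  linarith

/-- The second moments of the outcome probabilities of a Haar random state. -/
theorem integral_haar_mul {n : ℕ} (x y : Fin n → Bool) :
    ∫ ψ : Metric.sphere (0 : Qubits n) 1, ‖ψ.val x‖ ^ 2 * ‖ψ.val y‖ ^ 2 ∂haar n =
      (1 + if x = y then 1 else 0) / (2 ^ n * (2 ^ n + 1)) := by
  set a := ∫ ψ : Metric.sphere (0 : Qubits n) 1, ‖ψ.val x‖ ^ 4 ∂haar n with ha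
  have hI (z : Fin n → Bool) :
      ∫ ψ : Metric.sphere (0 : Qubits n) 1, ‖ψ.val x‖ ^ 2 * ‖ψ.val z‖ ^ 2 ∂haar n =
        a / 2 * (1 + if x = z then 1 else 0) := by
    split_ifs with h
    · subst h
      rw [ha]
      simp only [← pow_add]
      ring
    · rw [ha, integral_haar_pair h]
      ring
  -- Normalization in the second factor determines the only unknown `a`.
  have hsum : ∑ z : Fin n → Bool,
      ∫ ψ : Metric.sphere (0 : Qubits n) 1, ‖ψ.val x‖ ^ 2 * ‖ψ.val z‖ ^ 2 ∂haar n =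
        1 / 2 ^ n := by
    rw [← integral_finsetSum _ fun y _ => integrable_haar (by fun_prop), ← integral_haar_sq x]
    simp [← Finset.mul_sum, sum_measure_eq_one]
  simp only [hI, ← Finset.mul_sum, Finset.sum_add_distrib] at hsum
  simp only [Finset.sum_const, Finset.card_univ, Fintype.card_fun, Fintype.card_bool,
    Fintype.card_fin, nsmul_eq_mul, Nat.cast_pow, Nat.cast_ofNat, mul_one, Finset.sum_ite_eq,
    Finset.mem_univ, if_true] at hsum
  have : a / 2 = 1 / (2 ^ n * (2 ^ n + 1)) := by
    field_simp at hsum ⊢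
    linarith
  rw [hI, this]
  ring

/-! ### Collisions among samples, and closeness to uniform. -/

/-- The probability that two of `m` independent samples of `X` agree. -/
theorem sum_prod_collision {α : Type} [Fintype α] [DecidableEq α] {m : ℕ} (X : α → ℝ)
    (hX : ∑ x, X x = 1) {i j : Fin m} (hij : i ≠ j) :
    ∑ z : Fin m → α, (∏ k, X (z k)) * (if z i = z j then 1 else 0) = ∑ x, X x ^ 2 := by
  -- Splitting the event by the common value `x` makes the indicator a product over `k`, so the sum
  -- over tuples factorizes.
  have h1 (z : Fin m → α) : (∏ k, X (z k)) * (if z i = z j then (1 : ℝ) else 0) =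
      ∑ x, ∏ k, X (z k) * (if k = i ∨ k = j then (if z k = x then 1 else 0) else 1) := by
    simp only [Finset.prod_mul_distrib, ← Finset.mul_sum]
    congr 1
    have h2 (x : α) : (∏ k, if k = i ∨ k = j then (if z k = x then (1 : ℝ) else 0) else 1) =
        (if z i = x then 1 else 0) * (if z j = x then 1 else 0) := by
      rw [← Finset.prod_filter,
        show Finset.univ.filter (fun k => k = i ∨ k = j) = {i, j} by ext; simp,
        Finset.prod_pair hij]
    simp only [h2]
    simp [eq_comm]
  simp only [h1]
  rw [Finset.sum_comm]
  refine Finset.sum_congr rfl fun x _ => ?_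
  have h3 := Finset.prod_univ_sum (fun _ : Fin m => (Finset.univ : Finset α))
    (fun k y => X y * (if k = i ∨ k = j then (if y = x then (1 : ℝ) else 0) else 1))
  rw [Fintype.piFinset_univ] at h3
  rw [← h3]
  have h4 (k : Fin m) :
      ∑ y, X y * (if k = i ∨ k = j then (if y = x then (1 : ℝ) else 0) else 1) =
        if k = i ∨ k = j then X x else 1 := by
    split_ifs <;> simp [hX]
  simp only [h4]
  rw [← Finset.prod_filter,
    show Finset.univ.filter (fun k => k = i ∨ k = j) = {i, j} by ext; simp,
    Finset.prod_pair hij, sq]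

theorem sum_prod_eq_one {α : Type} [Fintype α] {m : ℕ} (X : α → ℝ)
    (hX : ∑ x, X x = 1) : ∑ z : Fin m → α, ∏ k, X (z k) = 1 := by
  have h := Finset.prod_univ_sum (fun _ : Fin m => (Finset.univ : Finset α)) (fun _ y => X y)
  rw [Fintype.piFinset_univ] at h
  simp [← h, hX]

/-- The birthday bound. -/
theorem sum_prod_not_injective_le {α : Type} [Fintype α] [DecidableEq α] {m : ℕ} (X : α → ℝ)
    (hX0 : ∀ x, 0 ≤ X x) (hX : ∑ x, X x = 1) :
    ∑ z : Fin m → α with ¬ Function.Injective z, ∏ k, X (z k) ≤ m ^ 2 * ∑ x, X x ^ 2 := by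
  -- Union bound over ordered pairs of distinct positions, of which there are at most `m ^ 2`.
  have h1 : ∑ z : Fin m → α with ¬ Function.Injective z, ∏ k, X (z k) ≤
      ∑ z : Fin m → α, ∑ p : Fin m × Fin m with p.1 ≠ p.2,
        (∏ k, X (z k)) * (if z p.1 = z p.2 then 1 else 0) := by
    rw [Finset.sum_filter]
    refine Finset.sum_le_sum fun z _ => ?_
    have hz : 0 ≤ ∏ k, X (z k) := Finset.prod_nonneg fun k _ => hX0 _
    have hnn : ∀ p ∈ Finset.univ.filter (fun p : Fin m × Fin m => p.1 ≠ p.2),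
        0 ≤ (∏ k, X (z k)) * (if z p.1 = z p.2 then (1 : ℝ) else 0) := by
      intro p _
      split_ifs <;> simp [hz]
    split_ifs with hi
    · exact Finset.sum_nonneg hnn
    · simp only [Function.Injective, not_forall] at hi
      obtain ⟨a, b, hab, hne⟩ := hi
      refine le_trans (le_of_eq ?_) (Finset.single_le_sum hnn (a := (a, b)) (by simpa using hne))
      simp [hab]
  refine h1.trans ?_
  rw [Finset.sum_comm, Finset.sum_congr rfl fun p hp =>
    sum_prod_collision X hX (Finset.mem_filter.1 hp).2, Finset.sum_const, nsmul_eq_mul]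
  refine mul_le_mul_of_nonneg_right ?_ (Finset.sum_nonneg fun x _ => sq_nonneg _)
  have := Finset.card_filter_le (Finset.univ : Finset (Fin m × Fin m)) fun p => p.1 ≠ p.2
  rw [Finset.card_univ, Fintype.card_prod, Fintype.card_fin] at this
  rw [sq]
  exact_mod_cast this

/-- Two distributions on tuples that are constant on the injective tuples are close when both
rarely produce a repetition. -/
theorem abs_sum_sub_le_of_const {β : Type} [Fintype β] (I : β → Prop) [DecidablePred I]
    (P U f : β → ℝ) (p u : ℝ) (hP : ∀ z, I z → P z = p) (hU : ∀ z, I z → U z = u)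
    (hP0 : ∀ z, 0 ≤ P z) (hU0 : ∀ z, 0 ≤ U z) (hP1 : ∑ z, P z = 1) (hU1 : ∑ z, U z = 1)
    (hf0 : ∀ z, 0 ≤ f z) (hf1 : ∀ z, f z ≤ 1) :
    |∑ z, P z * f z - ∑ z, U z * f z| ≤
      2 * (∑ z with ¬ I z, P z + ∑ z with ¬ I z, U z) := by
  have hP' : 0 ≤ ∑ z with ¬ I z, P z := Finset.sum_nonneg fun z _ => hP0 z
  have hU' : 0 ≤ ∑ z with ¬ I z, U z := Finset.sum_nonneg fun z _ => hU0 z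
  rw [← Finset.sum_sub_distrib,
    ← Finset.sum_filter_add_sum_filter_not Finset.univ I fun z => P z * f z - U z * f z]
  have hI : ∑ z with I z, (P z * f z - U z * f z) = (p - u) * ∑ z with I z, f z := by
    rw [Finset.mul_sum]
    refine Finset.sum_congr rfl fun z hz => ?_
    rw [hP z (Finset.mem_filter.1 hz).2, hU z (Finset.mem_filter.1 hz).2]
    ring
  -- Both total masses are `1`, so the masses of `I` differ exactly as much as those of its
  -- complement. Thus `I` and its complement each contribute at most the sum of the two
  -- complementary masses, whence the factor `2`.
  have hpu : |p - u| * (Finset.univ.filter I).card ≤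
      ∑ z with ¬ I z, P z + ∑ z with ¬ I z, U z := by
    have h1 : (p - u) * (Finset.univ.filter I).card =
        ∑ z with I z, P z - ∑ z with I z, U z := by
      rw [Finset.sum_congr rfl fun z hz => hP z (Finset.mem_filter.1 hz).2,
        Finset.sum_congr rfl fun z hz => hU z (Finset.mem_filter.1 hz).2]
      simp
      ring
    have h2 := Finset.sum_filter_add_sum_filter_not Finset.univ I P
    have h3 := Finset.sum_filter_add_sum_filter_not Finset.univ I U
    rw [← abs_of_nonneg (a := ((Finset.univ.filter I).card : ℝ)) (by positivity), ← abs_mul, h1,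
      abs_le]
    constructor <;> linarith
  have hF : |∑ z with I z, f z| ≤ (Finset.univ.filter I).card := by
    rw [abs_of_nonneg (Finset.sum_nonneg fun z _ => hf0 z)]
    simpa using Finset.sum_le_sum fun z (_ : z ∈ Finset.univ.filter I) => hf1 z
  have hJ : |∑ z with ¬ I z, (P z * f z - U z * f z)| ≤
      ∑ z with ¬ I z, P z + ∑ z with ¬ I z, U z := by
    refine (Finset.abs_sum_le_sum_abs _ _).trans ?_
    rw [← Finset.sum_add_distrib]
    refine Finset.sum_le_sum fun z _ => ?_
    have := mul_le_of_le_one_right (hP0 z) (hf1 z)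
    have := mul_le_of_le_one_right (hU0 z) (hf1 z)
    have := mul_nonneg (hP0 z) (hf0 z)
    have := mul_nonneg (hU0 z) (hf0 z)
    rw [abs_le]
    constructor <;> linarith
  refine (abs_add_le _ _).trans ?_
  rw [hI, abs_mul]
  have := mul_le_mul_of_nonneg_left hF (abs_nonneg (p - u))
  linarith

/-- `m` outcomes of measuring copies of a Haar random state are almost uniform. -/
theorem abs_integral_haar_sub_uniform_le {m n : ℕ} (f : (Fin m → Fin n → Bool) → ℝ)
    (hf0 : ∀ z, 0 ≤ f z) (hf1 : ∀ z, f z ≤ 1) :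
    |∫ ψ : Metric.sphere (0 : Qubits n) 1, (∑ z, (∏ i, ‖ψ.val (z i)‖ ^ 2) * f z) ∂haar n -
      ∑ z, (∏ _i : Fin m, (1 / 2 ^ n : ℝ)) * f z| ≤ 8 * (m ^ 2 / (2 ^ n + 1)) := by
  classical
  set P : (Fin m → Fin n → Bool) → ℝ := fun z =>
    ∫ ψ : Metric.sphere (0 : Qubits n) 1, (∏ i, ‖ψ.val (z i)‖ ^ 2) ∂haar n with hPdef
  have hint (z : Fin m → Fin n → Bool) : Integrable
      (fun ψ : Metric.sphere (0 : Qubits n) 1 => ∏ i, ‖ψ.val (z i)‖ ^ 2) (haar n) :=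
    integrable_haar (by fun_prop)
  have hsum : ∫ ψ : Metric.sphere (0 : Qubits n) 1,
      (∑ z, (∏ i, ‖ψ.val (z i)‖ ^ 2) * f z) ∂haar n = ∑ z, P z * f z := by
    rw [integral_finsetSum _ fun z _ => (hint z).mul_const _]
    simp only [integral_mul_const, hPdef]
  have hunif : ∑ _x : Fin n → Bool, (1 / 2 ^ n : ℝ) = 1 := by simp
  -- A permutation of the basis states carries any injective tuple to any other and preserves the
  -- Haar measure.
  have hconst (z w : Fin m → Fin n → Bool) (hz : Function.Injective z)
      (hw : Function.Injective w) : P z = P w := by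
    obtain ⟨σ, hσ⟩ := Equiv.Perm.exists_extending_pair z w hz hw
    simp only [hPdef]
    rw [← integral_haar_perm σ fun φ => ∏ i, ‖φ (z i)‖ ^ 2]
    simp [hσ]
  have hP0 (z) : 0 ≤ P z := integral_nonneg fun ψ => Finset.prod_nonneg fun i _ => by positivity
  have hP1 : ∑ z, P z = 1 := by
    rw [← integral_finsetSum _ fun z _ => hint z]
    simp [fun ψ : Metric.sphere (0 : Qubits n) 1 =>
      sum_prod_eq_one (m := m) (fun x => ‖ψ.val x‖ ^ 2) (sum_measure_eq_one ψ)]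
  -- The birthday bound for each fixed `ψ` is averaged; the mean collision probability is `2 / (2 ^
  -- n + 1)`.
  have hPI : ∑ z with ¬ Function.Injective z, P z ≤ 2 * (m ^ 2 / (2 ^ n + 1)) := by
    rw [← integral_finsetSum _ fun z _ => hint z]
    refine (integral_mono (integrable_haar (by fun_prop)) (integrable_haar (by fun_prop))
      fun ψ => sum_prod_not_injective_le (fun x => ‖ψ.val x‖ ^ 2) (fun x => by positivity)
        (sum_measure_eq_one ψ)).trans ?_
    simp only [sq (‖_‖ ^ 2)]
    rw [integral_const_mul, integral_finsetSum _ fun z _ => integrable_haar (by fun_prop)]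
    simp only [integral_haar_mul]
    simp
    field_simp
    norm_num
  have hUI : ∑ z : Fin m → Fin n → Bool with ¬ Function.Injective z,
      (∏ _i : Fin m, (1 / 2 ^ n : ℝ)) ≤ 2 * (m ^ 2 / (2 ^ n + 1)) := by
    refine (sum_prod_not_injective_le (fun _ => (1 / 2 ^ n : ℝ)) (fun x => by positivity)
      hunif).trans ?_
    have h1 : (1 : ℝ) ≤ 2 ^ n := one_le_pow₀ (by norm_num)
    simp only [Finset.sum_const, Finset.card_univ, Fintype.card_fun, Fintype.card_bool,
      Fintype.card_fin, nsmul_eq_mul, Nat.cast_pow, Nat.cast_ofNat]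
    rw [mul_div_assoc', mul_comm 2, mul_div_assoc]
    refine mul_le_mul_of_nonneg_left ?_ (by positivity)
    field_simp
    linarith
  rw [hsum]
  -- If `m > 2 ^ n`, no tuple is injective and any constant serves.
  have main : ∃ p, ∀ z, Function.Injective z → P z = p := by
    by_cases h : ∃ w : Fin m → Fin n → Bool, Function.Injective w
    · obtain ⟨w, hw⟩ := h
      exact ⟨P w, fun z hz => hconst z w hz hw⟩
    · exact ⟨0, fun z hz => (h ⟨z, hz⟩).elim⟩
  obtain ⟨p, hp⟩ := main
  refine (abs_sum_sub_le_of_const Function.Injective P (fun _ => ∏ _i : Fin m, (1 / 2 ^ n : ℝ)) f p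
    (∏ _i : Fin m, (1 / 2 ^ n : ℝ)) hp (fun _ _ => rfl) hP0 (fun z => by positivity) hP1
    (sum_prod_eq_one _ hunif) hf0 hf1).trans ?_
  linarith

/-! ### Moments of a single measured qubit. -/

theorem card_filter_bit {n : ℕ} (a : Fin n) :
    ((Finset.univ.filter fun x : Fin n → Bool => x a = true).card : ℝ) = 2 ^ n / 2 := by
  have h1 : (Finset.univ.filter fun x : Fin n → Bool => x a = true).card =
      (Finset.univ.filter fun x : Fin n → Bool => ¬ x a = true).card := by
    refine Finset.card_bij' (fun x _ => Function.update x a false)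
      (fun x _ => Function.update x a true) ?_ ?_ ?_ ?_ <;> simp +contextual
  have h2 := Finset.card_filter_add_card_filter_not (s := Finset.univ)
    (fun x : Fin n → Bool => x a = true)
  rw [← h1] at h2
  simp only [Finset.card_univ, Fintype.card_fun, Fintype.card_bool, Fintype.card_fin] at h2
  have h3 : (2 : ℝ) ^ n = ((2 ^ n : ℕ) : ℝ) := by norm_num
  rw [h3, ← h2]
  push_cast
  ring

/-- The probability that qubit `a` of a Haar random state is measured as `1` is `1/2`. -/
theorem integral_haar_bit {n : ℕ} (a : Fin n) :
    ∫ ψ : Metric.sphere (0 : Qubits n) 1, (∑ x with x a = true, ‖ψ.val x‖ ^ 2) ∂haar n =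
      1 / 2 := by
  rw [integral_finsetSum _ fun z _ => integrable_haar (by fun_prop)]
  simp only [integral_haar_sq, Finset.sum_const, nsmul_eq_mul, card_filter_bit]
  field_simp

/-- The second moment of the probability that qubit `a` of a Haar random state is measured
as `1`. -/
theorem integral_haar_bit_sq {n : ℕ} (a : Fin n) :
    ∫ ψ : Metric.sphere (0 : Qubits n) 1, (∑ x with x a = true, ‖ψ.val x‖ ^ 2) ^ 2 ∂haar n =
      1 / 4 + 1 / (4 * (2 ^ n + 1)) := by
  simp only [sq (∑ _x ∈ _, _), Finset.sum_mul_sum]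
  rw [integral_finsetSum _ fun z _ => integrable_haar (by fun_prop)]
  -- There are `2 ^ n / 2` strings `y`, and the diagonal one `y = x` counts twice.
  have h (x : Fin n → Bool) (hx : x ∈ Finset.univ.filter fun x : Fin n → Bool => x a = true) :
      ∫ ψ : Metric.sphere (0 : Qubits n) 1,
        (∑ y with y a = true, ‖ψ.val x‖ ^ 2 * ‖ψ.val y‖ ^ 2) ∂haar n =
      (2 ^ n / 2 + 1) / (2 ^ n * (2 ^ n + 1)) := by
    rw [integral_finsetSum _ fun z _ => integrable_haar (by fun_prop)]
    simp only [integral_haar_mul, ← Finset.sum_div, Finset.sum_add_distrib, Finset.sum_ite_eq, hx,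
      if_true, Finset.sum_const, nsmul_eq_mul, card_filter_bit, mul_one]
  rw [Finset.sum_congr rfl h, Finset.sum_const, nsmul_eq_mul, card_filter_bit]
  field_simp
  ring

/-! ### Quantum simulation of classical circuits -/

/-- The circuit `C` permutes the computational basis by `e`. -/
def QCircuit.Computes {W : Type} [DecidableEq W] (C : QCircuit W) (e : Equiv.Perm (W → Bool)) :
    Prop :=
  ∀ (ψ : Amp W) (y : W → Bool), C.run ψ (e y) = ψ y

theorem QCircuit.Computes.append {W : Type} [DecidableEq W] {C D : QCircuit W}
    {e f : Equiv.Perm (W → Bool)} (hC : C.Computes e) (hD : D.Computes f) :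
    QCircuit.Computes (List.append C D) (e.trans f) := by
  intro ψ y
  have h : QCircuit.run (List.append C D) ψ = D.run (C.run ψ) := List.foldl_append ..
  rw [h, Equiv.trans_apply, hD, hC]

/-- The circuit `C` adds the bit `r` to the qubit `t`, in the computational basis. -/
def QCircuit.XorsInto {W : Type} [DecidableEq W] (C : QCircuit W) (t : W)
    (r : (W → Bool) → Bool) : Prop :=
  ∃ e : Equiv.Perm (W → Bool), C.Computes e ∧
    ∀ y, e y = Function.update y t (xor (y t) (r y))

theorem QCircuit.xorsInto_nil {W : Type} [DecidableEq W] (t : W) :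
    QCircuit.XorsInto ([] : QCircuit W) t fun _ => false :=
  ⟨1, fun _ _ => rfl, fun y => by simp⟩

/-- As `r` does not depend on the qubit `t`, the map on basis states is an involution, so pulling
amplitudes back along it is the same as pushing them forward. -/
theorem QCircuit.xorsInto_singleton {W : Type} [DecidableEq W] (g : QGate W) (t : W)
    (r : (W → Bool) → Bool) (hr : ∀ y b, r (Function.update y t b) = r y)
    (hg : ∀ ψ y, g.apply ψ y = ψ (Function.update y t (xor (y t) (r y)))) :
    QCircuit.XorsInto [g] t r := by
  have hinv : Function.Involutive fun y : W → Bool =>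
      Function.update y t (xor (y t) (r y)) := by
    intro y
    simp [hr]
  refine ⟨hinv.toPerm, fun ψ y => ?_, fun y => rfl⟩
  change g.apply ψ _ = _
  rw [hg]
  exact congrArg ψ (hinv y)

theorem QCircuit.xorsInto_x {W : Type} [DecidableEq W] (t : W) :
    QCircuit.XorsInto [QGate.x t] t fun _ => true :=
  xorsInto_singleton _ _ _ (fun _ _ => rfl) fun ψ y => by simp [QGate.apply]

theorem QCircuit.xorsInto_cnot {W : Type} [DecidableEq W] {s t : W} (h : s ≠ t) :
    QCircuit.XorsInto [QGate.cnot s t h] t fun y => y s :=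
  xorsInto_singleton _ _ _ (fun y b => by simp [h]) fun ψ y => rfl

theorem QCircuit.xorsInto_ccnot {W : Type} [DecidableEq W] {s u t : W} (hsu : s ≠ u)
    (hst : s ≠ t) (hut : u ≠ t) :
    QCircuit.XorsInto [QGate.ccnot s u t hsu hst hut] t fun y => y s && y u :=
  xorsInto_singleton _ _ _ (fun y b => by simp [hst, hut]) fun ψ y => rfl

/-- A wire can be copied into an ancilla with at most one gate. -/
theorem exists_load {ι : Type} [DecidableEq ι] {K : ℕ} (w : Wire ι) (k : ℕ) (pos : ℕ → Fin K)
    (t : Fin K) (ht : ∀ j < k, pos j ≠ t) :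
    ∃ C : QCircuit (ι ⊕ Fin K), C.length ≤ 1 ∧ C.XorsInto (.inr t) fun y =>
      w.read (fun i => y (.inl i)) ((List.range k).map fun j => y (.inr (pos j))) := by
  cases w with
  | const b =>
    cases b
    · exact ⟨[], by simp, QCircuit.xorsInto_nil _⟩
    · exact ⟨[QGate.x (.inr t)], le_rfl, QCircuit.xorsInto_x _⟩
  | input i => exact ⟨[QGate.cnot (.inl i) (.inr t) (by simp)], le_rfl, QCircuit.xorsInto_cnot _⟩
  | gate j =>
    by_cases hj : j < k
    · refine ⟨[QGate.cnot (.inr (pos j)) (.inr t) (by simpa using ht j hj)], le_rfl, ?_⟩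
      convert QCircuit.xorsInto_cnot (W := ι ⊕ Fin K) _ using 2 with y
      simp [Wire.read, hj]
    -- A gate not yet computed reads as `false`, so the empty circuit loads it.
    · refine ⟨[], by simp, ?_⟩
      convert QCircuit.xorsInto_nil (W := ι ⊕ Fin K) _ using 2 with y
      simp [Wire.read, hj]

/-- One NAND gate is simulated with three ancillas and at most four gates. -/
theorem exists_nand {ι : Type} [DecidableEq ι] {K : ℕ} (g : Wire ι × Wire ι) (k : ℕ)
    (pos : ℕ → Fin K) (u v t : Fin K) (huv : u ≠ v) (hut : u ≠ t) (hvt : v ≠ t)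
    (hu : ∀ j < k, pos j ≠ u) (hv : ∀ j < k, pos j ≠ v) :
    ∃ C : QCircuit (ι ⊕ Fin K), C.length ≤ 4 ∧ ∃ e, C.Computes e ∧
      ∀ y : ι ⊕ Fin K → Bool, y (.inr u) = false → y (.inr v) = false → y (.inr t) = false →
        (∀ i, e y (.inl i) = y (.inl i)) ∧
        (∀ a, a ≠ u → a ≠ v → a ≠ t → e y (.inr a) = y (.inr a)) ∧
        e y (.inr t) =
          !(g.1.read (fun i => y (.inl i)) ((List.range k).map fun j => y (.inr (pos j))) &&
            g.2.read (fun i => y (.inl i)) ((List.range k).map fun j => y (.inr (pos j)))) := by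
  obtain ⟨C₁, l₁, e₁, c₁, h₁⟩ := exists_load g.1 k pos u hu
  obtain ⟨C₂, l₂, e₂, c₂, h₂⟩ := exists_load g.2 k pos v hv
  obtain ⟨e₃, c₃, h₃⟩ := QCircuit.xorsInto_ccnot (W := ι ⊕ Fin K) (s := .inr u) (u := .inr v)
    (t := .inr t) (by simpa using huv) (by simpa using hut) (by simpa using hvt)
  obtain ⟨e₄, c₄, h₄⟩ := QCircuit.xorsInto_x (W := ι ⊕ Fin K) (.inr t)
  refine ⟨_, ?_, _, c₁.append (c₂.append (c₃.append c₄)), ?_⟩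
  · simp only [List.append_eq, List.length_append, List.length_cons, List.length_nil]
    omega
  · intro y yu yv yt
    have hl : (List.range k).map (fun j => e₁ y (.inr (pos j))) =
        (List.range k).map fun j => y (.inr (pos j)) := by
      refine List.map_congr_left fun j hj => ?_
      simp [h₁, hu j (List.mem_range.1 hj)]
    have hi : (fun i => e₁ y (.inl i)) = fun i => y (.inl i) := by
      funext i
      simp [h₁]
    simp only [Equiv.trans_apply, h₄, h₃]
    refine ⟨fun i => ?_, fun a hau hav hat => ?_, ?_⟩
    · simp [h₁, h₂]
    · simp [h₁, h₂, hau, hav, hat]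
    · simp only [h₂, hl, hi]
      simp [h₁, huv, huv.symm, hut.symm, hvt.symm, yu, yv, yt]

/-- The values of a list of gates. -/
def gateValues {ι : Type} (gs : List (Wire ι × Wire ι)) (x : ι → Bool) : List Bool :=
  gs.foldl (fun v g => v ++ [!(g.1.read x v && g.2.read x v)]) []

theorem gateValues_concat {ι : Type} (gs : List (Wire ι × Wire ι)) (g : Wire ι × Wire ι)
    (x : ι → Bool) :
    gateValues (gs ++ [g]) x = gateValues gs x ++
      [!(g.1.read x (gateValues gs x) && g.2.read x (gateValues gs x))] := by
  simp [gateValues]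

/-- Gate `k` copies its inputs to ancillas `3 k` and `3 k + 1` and leaves its value in `3 k + 2`.
The induction carries along that later ancillas are still zero. Nothing is uncomputed: the circuit
permutes basis states, so leftover values cause no interference in the final measurement. -/
theorem exists_simulation {ι : Type} [DecidableEq ι] {K : ℕ} (a : ℕ → Fin K)
    (ha : ∀ i j, i < K → j < K → a i = a j → i = j) (gs : List (Wire ι × Wire ι))
    (hK : 3 * gs.length ≤ K) :
    ∃ C : QCircuit (ι ⊕ Fin K), C.length ≤ 4 * gs.length ∧ ∃ e, C.Computes e ∧
      ∀ x : ι → Bool,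
        (∀ i, e (Sum.elim x fun _ => false) (.inl i) = x i) ∧
        (∀ j, 3 * gs.length ≤ j → j < K → e (Sum.elim x fun _ => false) (.inr (a j)) = false) ∧
        (List.range gs.length).map (fun j => e (Sum.elim x fun _ => false) (.inr (a (3 * j + 2)))) =
          gateValues gs x := by
  induction gs using List.reverseRecOn with
  | nil => exact ⟨[], by simp, 1, fun _ _ => rfl, fun x => by simp [gateValues]⟩
  | append_singleton gs g ih =>
    rw [List.length_append, List.length_singleton] at hK ⊢
    obtain ⟨C, hl, e, hC, he⟩ := ih (by omega)
    set k := gs.length with hk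
    have hne (i j : ℕ) (hi : i < K) (hj : j < K) (hij : i ≠ j) : a i ≠ a j :=
      fun h => hij (ha i j hi hj h)
    obtain ⟨D, hl', f, hD, hf⟩ := exists_nand g k (fun j => a (3 * j + 2)) (a (3 * k))
      (a (3 * k + 1)) (a (3 * k + 2)) (hne _ _ (by omega) (by omega) (by omega))
      (hne _ _ (by omega) (by omega) (by omega)) (hne _ _ (by omega) (by omega) (by omega))
      (fun j hj => hne _ _ (by omega) (by omega) (by omega))
      (fun j hj => hne _ _ (by omega) (by omega) (by omega))
    refine ⟨_, ?_, _, hC.append hD, fun x => ?_⟩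
    · simp only [List.append_eq, List.length_append]
      omega
    · obtain ⟨h₁, h₂, h₃⟩ := he x
      obtain ⟨f₁, f₂, f₃⟩ := hf _ (h₂ _ (by omega) (by omega)) (h₂ _ (by omega) (by omega))
        (h₂ _ (by omega) (by omega))
      simp only [Equiv.trans_apply]
      refine ⟨fun i => (f₁ i).trans (h₁ i), fun j hj hjK => ?_, ?_⟩
      · rw [f₂ _ (hne _ _ hjK (by omega) (by omega)) (hne _ _ hjK (by omega) (by omega))
          (hne _ _ hjK (by omega) (by omega))]
        exact h₂ j (by omega) hjK
      · rw [List.range_succ, List.map_append, List.map_singleton, f₃, h₃, gateValues_concat,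
          ← h₃]
        congr 1
        · refine List.map_congr_left fun j hj => ?_
          have := List.mem_range.1 hj
          exact f₂ _ (hne _ _ (by omega) (by omega) (by omega))
            (hne _ _ (by omega) (by omega) (by omega)) (hne _ _ (by omega) (by omega) (by omega))
        · simp only [h₁]

/-- The probability that the test `T` accepts `m` independent samples of `D`. -/
def BoolCircuit.value {m n : ℕ} (T : BoolCircuit (Fin m × Fin n) Unit)
    (D : (Fin n → Bool) → ℝ) : ℝ :=
  ∑ z : Fin m → Fin n → Bool,
    (∏ i, D (z i)) * if T.eval (fun p => z p.1 p.2) () = true then 1 else 0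

/-- A permutation of basis states commutes with measuring in that basis, so the copies may be
measured first and `e` applied to the outcomes. -/
theorem QDistinguisher.accept_eq {m n : ℕ} (A : QDistinguisher m n)
    (e : Equiv.Perm (Fin m × Fin n ⊕ Fin A.anc → Bool)) (he : A.circuit.Computes e)
    (ψ : Amp (Fin n)) :
    A.accept ψ = ∑ z : Fin m → Fin n → Bool, (∏ i, measure ψ (z i)) *
      if e (Sum.elim (fun p => z p.1 p.2) fun _ => false) A.out = true then 1 else 0 := by
  rw [QDistinguisher.accept, ← Equiv.sum_comp e]
  have h (y : Fin m × Fin n ⊕ Fin A.anc → Bool) :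
      (if e y A.out = true then measure (A.circuit.run (copies m A.anc ψ)) (e y) else 0) =
        if (∀ k, y (.inr k) = false) then (∏ i, measure ψ fun j => y (.inl (i, j))) *
          (if e y A.out = true then 1 else 0) else 0 := by
    rw [measure, he, copies]
    split_ifs <;> simp [measure, Finset.prod_pow]
  simp only [h]
  rw [← Finset.sum_filter]
  symm
  refine Finset.sum_bij' (fun z _ => Sum.elim (fun p => z p.1 p.2) fun _ => false)
    (fun y _ i j => y (.inl (i, j))) ?_ ?_ ?_ ?_ ?_
  · simp
  · simp
  · simp
  · intro y hy
    funext p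
    rcases p with p | p
    · rfl
    · simpa using ((Finset.mem_filter.1 hy).2 p).symm
  · simp

/-- Every classical test of measurement outcomes is performed by a quantum algorithm. -/
theorem exists_qDistinguisher {m n : ℕ} (T : BoolCircuit (Fin m × Fin n) Unit) :
    ∃ A : QDistinguisher m n, A.time ≤ 7 * T.gates.length + 2 ∧
      ∀ ψ, A.accept ψ = T.value (measure ψ) := by
  set G := T.gates.length with hG
  set a : ℕ → Fin (3 * G + 1) := fun j => Fin.ofNat _ j with ha
  have hinj (i j : ℕ) (hi : i < 3 * G + 1) (hj : j < 3 * G + 1) (h : a i = a j) : i = j := by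
    have := congrArg Fin.val h
    simpa [ha, Fin.ofNat, Nat.mod_eq_of_lt hi, Nat.mod_eq_of_lt hj] using this
  obtain ⟨C, hl, e, hC, he⟩ := exists_simulation a hinj T.gates (by omega)
  -- The spare ancilla `3 * G` receives the output wire. In all there are `3 G + 1` ancillas and at
  -- most `4 G + 1` gates.
  obtain ⟨D, hl', f, hD, hf⟩ := exists_load (T.out ()) G (fun j => a (3 * j + 2)) (a (3 * G))
    (fun j hj h => by have := hinj _ _ (by omega) (by omega) h; omega)
  refine ⟨⟨3 * G + 1, List.append C D, .inr (a (3 * G))⟩, ?_, fun ψ => ?_⟩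
  · simp only [QDistinguisher.time, List.append_eq, List.length_append]
    omega
  · rw [QDistinguisher.accept_eq _ _ (hC.append hD), BoolCircuit.value]
    refine Finset.sum_congr rfl fun z _ => ?_
    obtain ⟨h₁, h₂, h₃⟩ := he fun p => z p.1 p.2
    simp only [Equiv.trans_apply, hf, Function.update_self, h₁]
    rw [h₂ (3 * G) le_rfl (by omega), h₃, Bool.false_xor]
    rfl

/-! ### Hardwiring inputs of classical circuits -/

/-- Replace input bits by constants or by other input bits. -/
def Wire.hardwire {ι κ : Type} (f : ι → Bool ⊕ κ) : Wire ι → Wire κ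
  | .const b => .const b
  | .input i => Sum.elim .const .input (f i)
  | .gate k => .gate k

theorem Wire.read_hardwire {ι κ : Type} (f : ι → Bool ⊕ κ) (x : κ → Bool) (v : List Bool)
    (w : Wire ι) : (w.hardwire f).read x v = w.read (fun i => Sum.elim id x (f i)) v := by
  cases w with
  | const b => rfl
  | input i =>
    simp only [Wire.hardwire, Wire.read]
    cases f i <;> rfl
  | gate k => rfl

/-- Replace input bits of a circuit by constants or by other input bits. -/
def BoolCircuit.hardwire {ι κ o : Type} (f : ι → Bool ⊕ κ) (c : BoolCircuit ι o) :
    BoolCircuit κ o where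
  gates := c.gates.map fun g => (g.1.hardwire f, g.2.hardwire f)
  out j := (c.out j).hardwire f

theorem BoolCircuit.eval_hardwire {ι κ o : Type} (f : ι → Bool ⊕ κ) (c : BoolCircuit ι o)
    (x : κ → Bool) : (c.hardwire f).eval x = c.eval fun i => Sum.elim id x (f i) := by
  have h : (c.hardwire f).values x = c.values fun i => Sum.elim id x (f i) := by
    simp only [BoolCircuit.values, BoolCircuit.hardwire, List.foldl_map, Wire.read_hardwire]
  funext j
  simp only [BoolCircuit.eval, h]
  exact Wire.read_hardwire f x _ _

/-- The tests obtained from a probabilistic algorithm by fixing a part `a` of its input and its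
coins `r`. -/
def ProbCircuit.test {α : Type} {m n : ℕ} (A : ProbCircuit (α ⊕ Fin m × Fin n) Unit)
    (a : α → Bool) (r : Fin A.coins → Bool) : BoolCircuit (Fin m × Fin n) Unit :=
  A.circuit.hardwire (Sum.elim (Sum.elim (fun i => .inl (a i)) .inr) fun i => .inl (r i))

/-- Acceptance is an average over the coins of deterministic tests, so a single good choice of coins
can later be fixed. -/
theorem acceptOnSamples_eq {α : Type} {m n : ℕ} (A : ProbCircuit (α ⊕ Fin m × Fin n) Unit)
    (a : α → Bool) (D : (Fin n → Bool) → ℝ) :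
    acceptOnSamples A a D =
      (∑ r : Fin A.coins → Bool, (A.test a r).value D) / 2 ^ A.coins := by
  simp only [acceptOnSamples, BoolCircuit.value]
  rw [Finset.sum_comm, Finset.sum_div]
  refine Finset.sum_congr rfl fun z _ => ?_
  rw [← Finset.mul_sum, mul_div_assoc, ProbCircuit.accept, ProbCircuit.prob, Finset.card_filter,
    Nat.cast_sum]
  congr 3 with r
  have h : (A.test a r).eval (fun p => z p.1 p.2) =
      A.circuit.eval (Sum.elim (Sum.elim a fun p => z p.1 p.2) r) := by
    rw [ProbCircuit.test, BoolCircuit.eval_hardwire]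
    congr 1
    funext i
    rcases i with (i | i) | i <;> rfl
  rw [h]
  have h' (g : Unit → Bool) : g = (fun _ => true) ↔ g () = true :=
    ⟨fun h => h ▸ rfl, fun h => funext fun _ => h⟩
  simp [h']

/-- A test as an algorithm that tosses no coins and ignores a part of its input. -/
def BoolCircuit.toProb (α : Type) {m n : ℕ} (T : BoolCircuit (Fin m × Fin n) Unit) :
    ProbCircuit (α ⊕ Fin m × Fin n) Unit where
  coins := 0
  circuit := T.hardwire fun p => .inr (.inl (.inr p))

theorem BoolCircuit.acceptOnSamples_toProb {α : Type} {m n : ℕ}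
    (T : BoolCircuit (Fin m × Fin n) Unit) (a : α → Bool) (D : (Fin n → Bool) → ℝ) :
    acceptOnSamples (T.toProb α) a D = T.value D := by
  rw [acceptOnSamples_eq]
  have h (r : Fin (T.toProb α).coins → Bool) : ((T.toProb α).test a r).value D = T.value D := by
    simp only [BoolCircuit.value, ProbCircuit.test, BoolCircuit.toProb,
      BoolCircuit.eval_hardwire]
    rfl
  simp only [h]
  change (∑ _r : Fin 0 → Bool, T.value D) / 2 ^ 0 = T.value D
  simp

/-- Some choice of the coins is at least as good as the average. -/
theorem exists_test_of_le {α : Type} {m n : ℕ} (A : ProbCircuit (α ⊕ Fin m × Fin n) Unit)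
    (a : α → Bool) (D E : (Fin n → Bool) → ℝ) (δ : ℝ)
    (h : δ ≤ |acceptOnSamples A a D - acceptOnSamples A a E|) :
    ∃ T : BoolCircuit (Fin m × Fin n) Unit, T.gates.length ≤ A.time ∧
      δ ≤ |T.value D - T.value E| := by
  rw [acceptOnSamples_eq, acceptOnSamples_eq, ← sub_div, ← Finset.sum_sub_distrib, abs_div,
    abs_of_pos (show (0 : ℝ) < 2 ^ A.coins by positivity), le_div_iff₀ (by positivity)] at h
  obtain ⟨r, -, hr⟩ := Finset.exists_le_of_sum_le (s := Finset.univ)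
    (f := fun _ : Fin A.coins → Bool => δ)
    (g := fun r => |(A.test a r).value D - (A.test a r).value E|) Finset.univ_nonempty (by
      refine le_trans (le_of_eq ?_) (h.trans (Finset.abs_sum_le_sum_abs _ _))
      simp [mul_comm])
  exact ⟨A.test a r, by simp [ProbCircuit.test, BoolCircuit.hardwire, ProbCircuit.time], hr⟩

/-- The sampler of the uniform distribution. -/
def uniformSampler (n : ℕ) : Sampler n where
  coins := n
  circuit := ⟨[], fun i => .input (.inr i)⟩

theorem uniformSampler_dist (n : ℕ) (y : Fin n → Bool) :
    (uniformSampler n).dist y = 1 / 2 ^ n := by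
  have h (inst : DecidablePred fun r : Fin n → Bool => r = y) :
      (Finset.univ.filter fun r : Fin n → Bool => r = y).card = 1 :=
    Finset.card_eq_one.2 ⟨y, by ext r; simp⟩
  exact (congrArg (fun c : ℕ => (c : ℝ) / 2 ^ n) (h fun r => Classical.propDecidable _)).trans
    (by simp)

/-! ### Asymptotics -/

theorem PolyBounded.affine {f : ℕ → ℕ} (hf : PolyBounded f) (a b : ℕ) :
    PolyBounded fun l => a * f l + b := by
  obtain ⟨p, hp⟩ := hf
  refine ⟨Polynomial.C a * p + Polynomial.C b, fun l => ?_⟩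
  simp only [Polynomial.eval_add, Polynomial.eval_mul, Polynomial.eval_C]
  have := Nat.mul_le_mul_left a (hp l)
  simpa using this

theorem PolyBounded.mono {f g : ℕ → ℕ} (hf : PolyBounded f) (h : ∀ l, g l ≤ f l) :
    PolyBounded g := by
  obtain ⟨p, hp⟩ := hf
  exact ⟨p, fun l => (h l).trans (hp l)⟩

theorem Negligible.abs {f : ℕ → ℝ} (hf : Negligible f) : Negligible fun l => |f l| :=
  Asymptotics.SuperpolynomialDecay.trans_abs_le hf fun _ => by simp

theorem Negligible.mul_poly {f : ℕ → ℝ} (hf : Negligible f) (p : Polynomial ℕ) :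
    Negligible fun l => f l * ((p.eval l : ℕ) : ℝ) := by
  refine (Asymptotics.SuperpolynomialDecay.mul_polynomial hf (p.map (Nat.castRingHom ℝ))).congr
    fun l => ?_
  simp [Polynomial.eval_natCast_map]

theorem Noticeable.not_le_negligible {ε δ : ℕ → ℝ} (hε : Noticeable ε) (hδ : Negligible δ)
    (h : ∀ l, ε l ≤ δ l) : False := by
  obtain ⟨p, hp⟩ := hε
  have h0 := hδ.mul_poly p 0
  simp only [pow_zero, one_mul] at h0
  obtain ⟨l, h1, h2⟩ := (hp.and (h0.eventually (gt_mem_nhds one_pos))).exists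
  exact absurd (h1.trans (mul_le_mul_of_nonneg_right (h l) (Nat.cast_nonneg _))) (not_le.2 h2)

/-! ### Tests of unidentifiable pseudorandom states -/

/-- Every efficient test accepts samples of every member of a classically unidentifiable
pseudorandom family as often as outcomes of measuring a Haar random state. -/
theorem CircuitFamily.exists_negligible_test (F : CircuitFamily)
    (hP : Pseudorandom F.n F.N F.state) (hU : F.ClassicallyUnidentifiable) (m : ℕ → ℕ)
    (T : (l : ℕ) → BoolCircuit (Fin (m l) × Fin (F.n l)) Unit) (hm : PolyBounded m)
    (hT : PolyBounded fun l => (T l).gates.length) :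
    ∃ ν : ℕ → ℝ, Negligible ν ∧ ∀ l i,
      |(T l).value (F.dist l i) -
        ∫ ψ : Metric.sphere (0 : Qubits (F.n l)) 1,
          (T l).value (measure fun y => ψ.val y) ∂haar (F.n l)| ≤ ν l := by
  choose A hA hAT using fun l => exists_qDistinguisher (T l)
  have h₁ := hP m A hm ((hT.affine 7 2).mono hA)
  obtain ⟨ν, hν, h₂⟩ := hU m (fun l => (T l).toProb _) hm (hT.mono fun l => by
    simp [BoolCircuit.toProb, ProbCircuit.time, BoolCircuit.hardwire])
  simp only [BoolCircuit.acceptOnSamples_toProb] at h₂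
  simp only [hAT] at h₁
  refine ⟨_, hν.abs.add h₁, fun l i => ?_⟩
  -- The intermediate value is the acceptance probability averaged over all keys.
  refine (abs_sub_le _ ((∑ k, (T l).value (measure (F.state l k))) / F.N l) _).trans
    (add_le_add ?_ le_rfl)
  have hN : (0 : ℝ) < F.N l := by exact_mod_cast F.N_pos l
  have h₃ : (T l).value (F.dist l i) - (∑ k, (T l).value (measure (F.state l k))) / F.N l =
      (∑ k, ((T l).value (F.dist l i) - (T l).value (F.dist l k))) / F.N l := by
    rw [Finset.sum_sub_distrib, sub_div]
    simp only [Finset.sum_const, Finset.card_univ, Fintype.card_fin, nsmul_eq_mul]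
    rw [mul_div_cancel_left₀ _ hN.ne']
    rfl
  rw [h₃, abs_div, abs_of_pos hN, div_le_iff₀ hN]
  refine (Finset.abs_sum_le_sum_abs _ _).trans ?_
  refine (Finset.sum_le_card_nsmul _ _ |ν l| fun k _ => ?_).trans (le_of_eq (by simp [mul_comm]))
  -- Unidentifiability concerns distinct keys only; the diagonal term vanishes. With a single key `ν
  -- l` may be negative, hence the bound by `|ν l|`.
  by_cases hik : i = k
  · simp [hik]
  · exact (h₂ l i k hik).trans (le_abs_self _)

/-! ### Two tests that bound the dimension from below. -/

/-- The test that outputs the bit `a` of a sample. -/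
def bitTest {n : ℕ} (a : Fin n) : BoolCircuit (Fin 1 × Fin n) Unit :=
  ⟨[], fun _ => .input (0, a)⟩

/-- The test that outputs the conjunction of the bits `a` of two samples. -/
def bitPairTest {n : ℕ} (a : Fin n) : BoolCircuit (Fin 2 × Fin n) Unit :=
  -- The second NAND gate, fed twice with the first, negates it.
  ⟨[(.input (0, a), .input (1, a)), (.gate 0, .gate 0)], fun _ => .gate 1⟩

theorem bitTest_value {n : ℕ} (a : Fin n) (D : (Fin n → Bool) → ℝ) :
    (bitTest a).value D = ∑ x with x a = true, D x := by
  rw [BoolCircuit.value, ← (Equiv.funUnique (Fin 1) (Fin n → Bool)).symm.sum_comp,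
    Finset.sum_filter]
  simp [bitTest, BoolCircuit.eval, Wire.read]

theorem bitPairTest_value {n : ℕ} (a : Fin n) (D : (Fin n → Bool) → ℝ) :
    (bitPairTest a).value D = (∑ x with x a = true, D x) ^ 2 := by
  rw [BoolCircuit.value, ← (finTwoArrowEquiv (Fin n → Bool)).symm.sum_comp,
    Fintype.sum_prod_type, sq, Finset.sum_filter, Finset.sum_mul_sum]
  refine Finset.sum_congr rfl fun x _ => Finset.sum_congr rfl fun y _ => ?_
  simp only [bitPairTest, BoolCircuit.eval, BoolCircuit.values, Wire.read, Fin.prod_univ_two]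
  cases hx : x a <;> cases hy : y a <;> simp [hx, hy]

/-- A classically unidentifiable pseudorandom family has superpolynomial dimension. -/
theorem CircuitFamily.exists_negligible_inv_dim (F : CircuitFamily)
    (hP : Pseudorandom F.n F.N F.state) (hU : F.ClassicallyUnidentifiable) :
    ∃ ν : ℕ → ℝ, Negligible ν ∧ ∀ l, 0 < F.n l → 1 / (2 ^ F.n l + 1) ≤ ν l := by
  obtain ⟨ν, hν, h₁⟩ := F.exists_negligible_test hP hU (fun _ => 1)
    (fun l => if h : 0 < F.n l then bitTest ⟨0, h⟩ else ⟨[], fun _ => .const true⟩)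
    ⟨1, fun l => by simp⟩ ⟨0, fun l => by dsimp only; split_ifs <;> simp [bitTest]⟩
  obtain ⟨μ, hμ, h₂⟩ := F.exists_negligible_test hP hU (fun _ => 2)
    (fun l => if h : 0 < F.n l then bitPairTest ⟨0, h⟩ else ⟨[], fun _ => .const true⟩)
    ⟨2, fun l => by simp⟩ ⟨2, fun l => by dsimp only; split_ifs <;> simp [bitPairTest]⟩
  -- The probability `p` of the bit is within `ν` of `1 / 2`, so `p² - 1 / 4 = (p - 1 / 2) + (p - 1
  -- / 2)²` is at most `ν + ν²`. The pair test gives `p² ≥ 1 / 4 + 1 / (4 (2 ^ n + 1)) - μ`.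
  -- Comparing the two yields the witness `4 (μ + ν + ν²)`.
  refine ⟨_, ((hμ.add hν).add (hν.mul hν)).const_mul 4, fun l hl => ?_⟩
  have i : Fin (F.N l) := ⟨0, F.N_pos l⟩
  replace h₁ := h₁ l i
  replace h₂ := h₂ l i
  rw [dif_pos hl] at h₁ h₂
  simp only [bitTest_value, bitPairTest_value, measure, integral_haar_bit,
    integral_haar_bit_sq] at h₁ h₂
  set p := ∑ x with x ⟨0, hl⟩ = true, F.dist l i x
  have h₃ : 1 / (4 * (2 ^ F.n l + 1)) = 1 / (2 ^ F.n l + 1) / (4 : ℝ) := by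
    rw [div_div, mul_comm]
  have h₄ : (p - 1 / 2) ^ 2 ≤ ν l * ν l := by
    rw [← sq, ← sq_abs]
    exact pow_le_pow_left₀ (abs_nonneg _) h₁ 2
  rw [h₃] at h₂
  simp only [Pi.add_apply, Pi.mul_apply]
  nlinarith [(abs_le.1 h₁).2, (abs_le.1 h₂).1]

/-- Every gate acts on some qubit, so without qubits the circuit is empty and the only outcome is
the empty string. -/
theorem CircuitFamily.dist_eq_of_n_eq_zero (F : CircuitFamily) (l : ℕ) (hl : F.n l = 0)
    (k : Fin (F.N l)) : F.dist l k = fun _ => 1 / 2 ^ F.n l := by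
  have hemp : IsEmpty (Fin (F.n l)) := by rw [hl]; infer_instance
  have hC : F.circ l k = [] := by
    refine List.eq_nil_iff_forall_not_mem.2 fun g _ => ?_
    cases g <;> exact isEmptyElim ‹Fin (F.n l)›
  funext y
  have hy : y = fun _ => false := Subsingleton.elim _ _
  simp [CircuitFamily.dist, CircuitFamily.state, hC, QCircuit.state, QCircuit.run, ket, measure, hy,
    hl]

end RCS

end

/-! ### The contradiction with a verifiable quantum advantage. -/

theorem mainTheorem3 (F : RCS.CircuitFamily) (s t : ℕ → ℕ) (ε : ℕ → ℝ)
    (hs : ∀ l, F.n l ≤ s l) (ht : RCS.PolyBounded t) (hε : RCS.Noticeable ε)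
    (hF : F.VQA s t ε) :
    ¬ (RCS.IsPRS F.n F.N F.state ∧ F.ClassicallyUnidentifiable) := by
  rintro ⟨hPRS, hU⟩
  obtain ⟨m, A, hA⟩ := hF (fun l => RCS.uniformSampler (F.n l)) fun l => by
    simpa [RCS.ProbCircuit.time, RCS.uniformSampler] using hs l
  have hdist (l : ℕ) : (RCS.uniformSampler (F.n l)).dist = fun _ => 1 / 2 ^ F.n l :=
    funext (RCS.uniformSampler_dist _)
  have hex (l : ℕ) : ∃ k, ∃ T : RCS.BoolCircuit (Fin (m l) × Fin (F.n l)) Unit,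
      T.gates.length ≤ (A l).time ∧
        ε l ≤ |T.value (F.dist l k) - T.value fun _ => 1 / 2 ^ F.n l| := by
    have hN : (0 : ℝ) < F.N l := by exact_mod_cast F.N_pos l
    have h := (hA l).2.2
    rw [le_div_iff₀ hN] at h
    have hne : (Finset.univ : Finset (Fin (F.N l))).Nonempty := ⟨⟨0, F.N_pos l⟩, Finset.mem_univ _⟩
    -- Some key attains at least the average advantage.
    obtain ⟨k, -, hk⟩ := Finset.exists_le_of_sum_le (s := Finset.univ)
      (f := fun _ : Fin (F.N l) => ε l) hne (by simpa [mul_comm] using h)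
    rw [hdist] at hk
    exact ⟨k, RCS.exists_test_of_le _ _ _ _ _ hk⟩
  choose k T hT hTε using hex
  obtain ⟨ν, hν, h₁⟩ := F.exists_negligible_test hPRS.pseudorandom hU m T
    (ht.mono fun l => (hA l).1) (ht.mono fun l => (hT l).trans (hA l).2.1)
  obtain ⟨μ, hμ, h₂⟩ := F.exists_negligible_inv_dim hPRS.pseudorandom hU
  obtain ⟨p, hp⟩ := ht
  -- The first term is the passage from the chosen key to a Haar random state, the second the
  -- birthday error, with `m ≤ t ≤ p`.
  refine hε.not_le_negligible (hν.abs.add ((hμ.abs.mul_poly (p ^ 2)).const_mul 8)) fun l => ?_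
  simp only [Pi.add_apply]
  rcases Nat.eq_zero_or_pos (F.n l) with hl | hl
  · refine (hTε l).trans ?_
    rw [F.dist_eq_of_n_eq_zero l hl, sub_self, abs_zero]
    positivity
  · refine (hTε l).trans ((abs_sub_le _ _ _).trans
      (add_le_add ((h₁ l (k l)).trans (le_abs_self _)) ?_))
    refine (RCS.abs_integral_haar_sub_uniform_le _ (fun z => by split_ifs <;> simp)
      fun z => by split_ifs <;> simp).trans ?_
    refine mul_le_mul_of_nonneg_left ?_ (by norm_num)
    have hm : ((m l : ℕ) : ℝ) ≤ (p.eval l : ℕ) := by exact_mod_cast (hA l).1.trans (hp l)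
    rw [Polynomial.eval_pow, Nat.cast_pow, div_eq_mul_one_div, mul_comm]
    exact mul_le_mul ((h₂ l hl).trans (le_abs_self _))
      (pow_le_pow_left₀ (Nat.cast_nonneg _) hm 2) (by positivity) (abs_nonneg _)
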